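/- Let $P$ be a finite set of $n$ points in the Euclidean plane, no three of them collinear. For an angle $\theta$ let $X_\theta, Y_\theta$ be the coordinate axes rotated counterclockwise by $\theta$. The (first) $\theta$-quadrant with apex $a$ is the open set of points whose two rotated coordinates are both strictly greater than those of $a$; it is $P$-free if it contains no point of $P$. It is extremal if it is $P$-free and each of its two bounding rays passes through a point of $P$ different from $a$. The points of $P$ that are apices of $P$-free $\theta$-quadrants are the vertices of the staircase of $P$ at $\theta$; the staircase is the monotone chain that runs from the rightmost to the topmost of these vertices (with respect to $X_\theta, Y_\theta$) and turns, between consecutive vertices, at the apices of the extremal $\theta$-quadrants. For every edge $e=\overline{uv}$ of the convex hull of $P$, directed counterclockwise from $u$ to $v$ (if $n=2$, the segment with its two orientations counts as two edges), the subchain $A_e(P)$ is the set of all points that, for some $\theta$ in a complete rotation, lie on the part of the staircase at $\theta$ leading from $u$ to $v$ and are either the apex of an extremal $\theta$-quadrant or a vertex of the staircase (a point of $P$). The arc chain $\mathcal A(P)$ is the sequence of all subchains. Order the points of $P\cap A_e(P)$ by their orthogonal projections on $e$, from $u$ to $v$. For two consecutive ones $p,q$, the link with endpoints $p,q$ is the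 set of all points of $A_e(P)$ whose projection on $e$ lies between those of $p$ and $q$ (inclusive). Then the following hold. 1. Two distinct links in the same subchain have at most one common point, and such a point is an endpoint of both links. 2. Two links in different subchains have at most two common points. 3. There is an absolute constant $C$ such that, for all such $P$, at most $C\,n$ (ordered) pairs of distinct links of $\mathcal A(P)$ have a common point. 4. There is an absolute constant $C$ such that, for all such $P$, at most $C\,n$ points of the plane lie in two distinct links of $\mathcal A(P)$. That is, the links contained in $\mathcal A(P)$ have $O(n)$ intersection points in total. -/

import Mathlib

namespace ArcChain

/-- The Euclidean plane. -/
abbrev Plane : Type := EuclideanSpace ℝ (Fin 2)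

/-- First coordinate of `p` in the coordinate system rotated counterclockwise by `θ`. -/
noncomputable def X (θ : ℝ) (p : Plane) : ℝ := Real.cos θ * p 0 + Real.sin θ * p 1

/-- Second coordinate of `p` in the coordinate system rotated counterclockwise by `θ`. -/
noncomputable def Y (θ : ℝ) (p : Plane) : ℝ := -Real.sin θ * p 0 + Real.cos θ * p 1

/-- No three (distinct) points of `P` lie on a line. -/
def NoThreeCollinear (P : Finset Plane) : Prop :=
  ∀ a ∈ P, ∀ b ∈ P, ∀ c ∈ P, a ≠ b → a ≠ c → b ≠ c → ¬ Collinear ℝ ({a, b, c} : Set Plane)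

/-- The (open) first `θ`-quadrant with apex `a`. -/
def quadrant (θ : ℝ) (a : Plane) : Set Plane := {z | X θ a < X θ z ∧ Y θ a < Y θ z}

/-- The first `θ`-quadrant with apex `a` contains no point of `P`. -/
def IsFree (P : Finset Plane) (θ : ℝ) (a : Plane) : Prop := ∀ p ∈ P, p ∉ quadrant θ a

/-- `p` is a vertex of the staircase of `P` at angle `θ`:
a point of `P` that is the apex of a `P`-free first `θ`-quadrant. -/
def IsStaircaseVertex (P : Finset Plane) (θ : ℝ) (p : Plane) : Prop := p ∈ P ∧ IsFree P θ p

/-- The first `θ`-quadrant with apex `a` is extremal: it is `P`-free, and both of its bounding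
rays pass through (are supported by) a point of `P` other than the apex. Equivalently, `a` is a
clockwise-turn vertex of the staircase of `P` at `θ`, i.e. the corner between two consecutive
points of `P` on that staircase. -/
def IsExtremal (P : Finset Plane) (θ : ℝ) (a : Plane) : Prop :=
  IsFree P θ a ∧
    (∃ p ∈ P, Y θ p = Y θ a ∧ X θ a < X θ p) ∧
    (∃ q ∈ P, X θ q = X θ a ∧ Y θ a < Y θ q)

/-- `(u, v)` is an edge of the convex hull of `P`, directed counterclockwise: all of `P` lies
on the left of the line from `u` to `v` or on it. (If `P` has exactly two points, the
two orientations of the segment between them are two edges.) -/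
def IsHullEdge (P : Finset Plane) (u v : Plane) : Prop :=
  u ∈ P ∧ v ∈ P ∧ u ≠ v ∧
    ∀ w ∈ P, 0 ≤ (v 0 - u 0) * (w 1 - u 1) - (v 1 - u 1) * (w 0 - u 0)

/-- In the staircase at angle `θ`, which runs from its rightmost to its topmost point and along
which the first rotated coordinate decreases and the second one increases (both weakly),
the point `a` comes after `u` and before `v`. -/
def IsBetween (θ : ℝ) (u v a : Plane) : Prop :=
  X θ v ≤ X θ a ∧ X θ a ≤ X θ u ∧ Y θ u ≤ Y θ a ∧ Y θ a ≤ Y θ v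

/-- The subchain of `P` corresponding to the hull edge from `u` to `v`, as a set of points:
the union of the extremal arcs traced by the apices of the extremal `θ`-quadrants that belong to
the part of the staircase connecting `u` to `v`, while `θ` makes a complete rotation, together
with the points of `P` that are vertices of that part of the staircase for some `θ` (these are the
end points of the arcs that lie in `P`). -/
def subchain (P : Finset Plane) (u v : Plane) : Set Plane :=
  {a | ∃ θ : ℝ, (IsExtremal P θ a ∨ IsStaircaseVertex P θ a) ∧ IsBetween θ u v a}

/-- The position of the orthogonal projection of `a` on the line from `u` to `v`
(up to the positive factor `dist u v`), measured from `u`. -/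
noncomputable def proj (u v a : Plane) : ℝ := inner ℝ (a - u) (v - u)

/-- A link of the arc chain of `P`: a directed hull edge `(src, tgt)` and two points `fst`, `snd`
of `P` on the subchain of that edge that are consecutive in the order of
the projections on the edge. -/
structure Link (P : Finset Plane) where
  /-- first end point of the hull edge -/
  src : Plane
  /-- second end point of the hull edge -/
  tgt : Plane
  /-- first end point of the link -/
  fst : Plane
  /-- second end point of the link -/
  snd : Plane
  isHullEdge : IsHullEdge P src tgt
  fst_mem : fst ∈ P
  snd_mem : snd ∈ P
  fst_mem_subchain : fst ∈ subchain P src tgt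
  snd_mem_subchain : snd ∈ subchain P src tgt
  lt : proj src tgt fst < proj src tgt snd
  consecutive : ∀ p ∈ P, p ∈ subchain P src tgt →
    proj src tgt p ≤ proj src tgt fst ∨ proj src tgt snd ≤ proj src tgt p

/-- The set of points of a link: the part of the subchain between its two end points. -/
def Link.carrier {P : Finset Plane} (L : Link P) : Set Plane :=
  {a | a ∈ subchain P L.src L.tgt ∧
    proj L.src L.tgt L.fst ≤ proj L.src L.tgt a ∧ proj L.src L.tgt a ≤ proj L.src L.tgt L.snd}

/-- Two links belong to the same subchain: they come from the same directed hull edge. -/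
def Link.SameSubchain {P : Finset Plane} (L M : Link P) : Prop :=
  L.src = M.src ∧ L.tgt = M.tgt

end ArcChain

/-!
Everything rests on two elementary facts about the quadrants that witness points of a subchain.

* An apex of an extremal quadrant lies in no free quadrant that is turned by at most a right angle,
  since otherwise one of the two supporting points would lie in it, too (`not_mem_quadrant`). Hence a
  subchain is a graph over its edge (`proj_injOn`), and two links of one subchain can share only
  an end point.
* Two hull edges facing a direction `d` have disjoint interiors when seen along `d`
  (`IsHullEdge.eq_of_overlap`). Hence quadrants with the same apex that cross different edges are
  disjoint (`OnChain.edge_eq`).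

*Two common points.* A link is strictly concave: if `b` lies between `a` and `c` on a link, then
`a` and `c` belong to the disk whose diameter is spanned by the two points supporting the quadrant
at `b`, and this quadrant separates `a` from `c` (`Link.exists_middle`). In particular the triangle
`a b c` has an angle of at least 90° at `b`. If two links of different subchains had three common
points, the same one would be in the middle for both of them, and both quadrants at this point
would fit into the angle of the triangle, which is less than 180°. Two right angles in it overlap,
a contradiction.

*Linearly many pairs.* Every quadrant contains one of eight fixed directions. A link is determined
by one of its end points and the direction in the quadrant there, up to end points of hull edges, so
there are `O(n)` links. Links meeting at a point of `P` share an end point, which gives `O(n)` pairs.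
For the other pairs `(L, M)`, crossing at `z`, fix the directions `d` and `d'` in the two quadrants
at `z`, with `d'` clockwise from `d`, say. The links `L` are ordered transversally to `d`, the links
`M` transversally to `d'` (`Visits.separated`). The essential point is `Visits.not_zigzag`: no pair
`(L, M)` has both a crossing of `L` with a link farther than `M` in the one order and a crossing
of `M` with a link farther than `L` in the other one. So every pair is extreme for `L` or extreme
for `M`, and there are at most twice as many pairs as links (`encard_le_of_no_two_smaller`).

The number of intersection points is at most twice the number of pairs.
-/

namespace ArcChain

/-- The cross product (signed area) of two plane vectors. -/
def cr (a b : Plane) : ℝ := a 0 * b 1 - a 1 * b 0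

/-- The scalar product of two plane vectors, in coordinates. -/
def dt (a b : Plane) : ℝ := a 0 * b 0 + a 1 * b 1

/-- The direction `d` points into the open first `θ`-quadrants. -/
def InCone (θ : ℝ) (d : Plane) : Prop := 0 < X θ d ∧ 0 < Y θ d

/-- The point `a` lies on the subchain of the hull edge from `u` to `v`, as witnessed by
the quadrant at angle `θ`. -/
def OnChain (P : Finset Plane) (u v : Plane) (θ : ℝ) (a : Plane) : Prop :=
  IsHullEdge P u v ∧ (IsExtremal P θ a ∨ IsStaircaseVertex P θ a) ∧ IsBetween θ u v a

/-! ### Rotated coordinates -/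

lemma X_sub (θ : ℝ) (a b : Plane) : X θ (a - b) = X θ a - X θ b := by
  simp only [X, PiLp.sub_apply]; ring

lemma Y_sub (θ : ℝ) (a b : Plane) : Y θ (a - b) = Y θ a - Y θ b := by
  simp only [Y, PiLp.sub_apply]; ring

lemma cr_eq (θ : ℝ) (a b : Plane) : cr a b = X θ a * Y θ b - Y θ a * X θ b := by
  simp only [cr, X, Y]
  linear_combination -(a 0 * b 1 - a 1 * b 0) * Real.sin_sq_add_cos_sq θ

lemma dt_eq (θ : ℝ) (a b : Plane) : dt a b = X θ a * X θ b + Y θ a * Y θ b := by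
  simp only [dt, X, Y]
  linear_combination -(a 0 * b 0 + a 1 * b 1) * Real.sin_sq_add_cos_sq θ

lemma eq_of_X_Y (θ : ℝ) {a b : Plane} (hx : X θ a = X θ b) (hy : Y θ a = Y θ b) : a = b := by
  have h := Real.sin_sq_add_cos_sq θ
  simp only [X, Y] at hx hy
  ext i
  fin_cases i
  · show a 0 = b 0
    linear_combination Real.cos θ * hx - Real.sin θ * hy - (a 0 - b 0) * h
  · show a 1 = b 1
    linear_combination Real.sin θ * hx + Real.cos θ * hy - (a 1 - b 1) * h

/-- Change of frame. -/
lemma X_rotate (θ θ' : ℝ) (w : Plane) :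
    X θ' w = Real.cos (θ - θ') * X θ w - Real.sin (θ - θ') * Y θ w := by
  rw [Real.cos_sub, Real.sin_sub]; simp only [X, Y]
  linear_combination -(Real.cos θ' * w 0 + Real.sin θ' * w 1) * Real.sin_sq_add_cos_sq θ

/-- Change of frame. -/
lemma Y_rotate (θ θ' : ℝ) (w : Plane) :
    Y θ' w = Real.sin (θ - θ') * X θ w + Real.cos (θ - θ') * Y θ w := by
  rw [Real.cos_sub, Real.sin_sub]; simp only [X, Y]
  linear_combination -(-Real.sin θ' * w 0 + Real.cos θ' * w 1) * Real.sin_sq_add_cos_sq θ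

lemma dt_self_pos {a : Plane} (h : a ≠ 0) : 0 < dt a a := by
  by_contra hn
  simp only [dt] at hn
  apply h
  ext i
  fin_cases i
  · show a 0 = 0
    nlinarith [mul_self_nonneg (a 0), mul_self_nonneg (a 1)]
  · show a 1 = 0
    nlinarith [mul_self_nonneg (a 0), mul_self_nonneg (a 1)]

lemma cr_sub_right (d a b : Plane) : cr d (a - b) = cr d a - cr d b := by
  simp only [cr, PiLp.sub_apply]; ring

lemma dt_sub_left (a b d : Plane) : dt (a - b) d = dt a d - dt b d := by
  simp only [dt, PiLp.sub_apply]; ring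

lemma proj_eq (u v a : Plane) : proj u v a = dt (a - u) (v - u) := by
  simp only [proj, dt, PiLp.inner_apply, Fin.sum_univ_two, PiLp.sub_apply, RCLike.inner_apply,
    conj_trivial]
  ring

lemma proj_sub_proj (θ : ℝ) (u v a b : Plane) : proj u v b - proj u v a =
    (X θ v - X θ u) * (X θ b - X θ a) + (Y θ v - Y θ u) * (Y θ b - Y θ a) := by
  rw [proj_eq, proj_eq, dt_eq θ, dt_eq θ]
  simp only [X_sub, Y_sub]; ring

lemma cr_edge_eq (θ : ℝ) (u v a : Plane) : cr (v - u) (a - u) =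
    (X θ v - X θ u) * (Y θ a - Y θ u) - (Y θ v - Y θ u) * (X θ a - X θ u) := by
  rw [cr_eq θ]; simp only [X_sub, Y_sub]

lemma IsHullEdge.cr_nonneg {P : Finset Plane} {u v : Plane} (h : IsHullEdge P u v) {w : Plane}
    (hw : w ∈ P) : 0 ≤ cr (v - u) (w - u) := by
  simpa [cr] using h.2.2.2 w hw

/-- Two frames whose open quadrants share a direction are less than a right angle apart. -/
lemma InCone.cos_nonneg {θ θ' : ℝ} {d : Plane} (h : InCone θ d) (h' : InCone θ' d) :
    0 ≤ Real.cos (θ - θ') := by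
  have h1 : 0 < X θ d * X θ' d + Y θ d * Y θ' d :=
    add_pos (mul_pos h.1 h'.1) (mul_pos h.2 h'.2)
  have h2 : X θ d * X θ' d + Y θ d * Y θ' d = Real.cos (θ - θ') * (d 0 ^ 2 + d 1 ^ 2) := by
    rw [Real.cos_sub]; simp only [X, Y]; ring
  by_contra hc
  nlinarith [sq_nonneg (d 0), sq_nonneg (d 1)]

/-- Two quadrants that are crossed by the same edge are at most a right angle apart. -/
lemma IsBetween.cos_nonneg {θ θ' : ℝ} {u v a b : Plane} (huv : u ≠ v)
    (h : IsBetween θ u v a) (h' : IsBetween θ' u v b) : 0 ≤ Real.cos (θ - θ') := by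
  obtain ⟨h1, h2, h3, h4⟩ := h
  obtain ⟨k1, k2, k3, k4⟩ := h'
  have e1 : 0 ≤ (X θ v - X θ u) * (X θ' v - X θ' u) + (Y θ v - Y θ u) * (Y θ' v - Y θ' u) :=
    add_nonneg (mul_nonneg_of_nonpos_of_nonpos (by linarith) (by linarith))
      (mul_nonneg (by linarith) (by linarith))
  have e2 : (X θ v - X θ u) * (X θ' v - X θ' u) + (Y θ v - Y θ u) * (Y θ' v - Y θ' u)
      = Real.cos (θ - θ') * dt (v - u) (v - u) := by
    rw [Real.cos_sub]; simp only [X, Y, dt, PiLp.sub_apply]; ring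
  have e3 : 0 < dt (v - u) (v - u) := dt_self_pos (sub_ne_zero.2 huv.symm)
  by_contra hc
  nlinarith

/-- An extremal apex (or staircase vertex) lies in no free quadrant
whose angle differs by at most a right angle: one of the two supporting points would lie in that
quadrant, too. -/
lemma not_mem_quadrant {P : Finset Plane} {θ θ' : ℝ} {a b : Plane}
    (ha : IsExtremal P θ a ∨ IsStaircaseVertex P θ a) (hb : IsFree P θ' b)
    (hc : 0 ≤ Real.cos (θ - θ')) : a ∉ quadrant θ' b := by
  intro hab
  rcases ha with ⟨-, ⟨p, hp, hp1, hp2⟩, ⟨q, hq, hq1, hq2⟩⟩ | ⟨hP, -⟩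
  · have hX := X_rotate θ θ'
    have hY := Y_rotate θ θ'
    obtain ⟨h1, h2⟩ := hab
    rcases le_total 0 (Real.sin (θ - θ')) with hs | hs
    · refine hb p hp ⟨?_, ?_⟩
      · rw [hX p, hp1]; rw [hX a] at h1; nlinarith
      · rw [hY p, hp1]; rw [hY a] at h2; nlinarith
    · refine hb q hq ⟨?_, ?_⟩
      · rw [hX q, hq1]; rw [hX a] at h1; nlinarith
      · rw [hY q, hq1]; rw [hY a] at h2; nlinarith
  · exact hb a hP hab

/-! ### Points of a subchain -/

section Chain
variable {P : Finset Plane} {u v a b : Plane} {θ θ' : ℝ}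

lemma exists_onChain (he : IsHullEdge P u v) (ha : a ∈ subchain P u v) :
    ∃ θ, OnChain P u v θ a := by
  obtain ⟨θ, h1, h2⟩ := ha
  exact ⟨θ, he, h1, h2⟩

lemma OnChain.free (h : OnChain P u v θ a) : IsFree P θ a := by
  rcases h.2.1 with h | h
  exacts [h.1, h.2]

lemma OnChain.not_mem_quadrant (h : OnChain P u v θ a) (h' : OnChain P u v θ' b) :
    a ∉ quadrant θ' b :=
  ArcChain.not_mem_quadrant h.2.1 h'.free (IsBetween.cos_nonneg h.1.2.2.1 h.2.2 h'.2.2)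

lemma OnChain.extremal (h : OnChain P u v θ a) (ha : a ∉ P) : IsExtremal P θ a := by
  rcases h.2.1 with h | h
  exacts [h, absurd h.1 ha]

/-- The subchain lies on the same side of its edge as `P`. -/
lemma OnChain.cr_nonneg (h : OnChain P u v θ a) : 0 ≤ cr (v - u) (a - u) := by
  obtain ⟨he, h1, b1, b2, b3, b4⟩ := h
  rcases h1 with ⟨-, ⟨p, hp, hp1, hp2⟩, -⟩ | h1
  · have := he.cr_nonneg hp
    rw [cr_edge_eq θ] at this ⊢
    rw [hp1] at this
    nlinarith
  · exact he.cr_nonneg h1.1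

/-- A quadrant whose apex is not in `P` crosses the edge with neither arm parallel to it. -/
lemma OnChain.strict (h : OnChain P u v θ a) (ha : a ∉ P) : X θ v < X θ u ∧ Y θ u < Y θ v := by
  obtain ⟨-, ⟨p, hp, hp1, hp2⟩, ⟨q, hq, hq1, hq2⟩⟩ := h.extremal ha
  obtain ⟨he, -, b1, b2, b3, b4⟩ := h
  have hp' := he.cr_nonneg hp
  have hq' := he.cr_nonneg hq
  rw [cr_edge_eq θ] at hp' hq'
  constructor
  · by_contra hc
    have h1 : X θ v = X θ u := by linarith
    have h2 : Y θ v = Y θ u := by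
      rw [h1] at hp'
      nlinarith
    exact he.2.2.1 (eq_of_X_Y θ h1 h2).symm
  · by_contra hc
    have h2 : Y θ v = Y θ u := by linarith
    have h1 : X θ v = X θ u := by
      rw [h2] at hq'
      nlinarith
    exact he.2.2.1 (eq_of_X_Y θ h1 h2).symm

lemma OnChain.cr_eq_zero_or_strict (h : OnChain P u v θ a) :
    cr (v - u) (a - u) = 0 ∨ (X θ v < X θ u ∧ Y θ u < Y θ v) := by
  obtain ⟨he, -, b1, b2, b3, b4⟩ := h
  rw [cr_edge_eq θ]
  by_cases h1 : X θ v < X θ u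
  · by_cases h2 : Y θ u < Y θ v
    · exact Or.inr ⟨h1, h2⟩
    · left
      have e1 : Y θ v = Y θ u := by linarith
      have e2 : Y θ a = Y θ u := by linarith
      rw [e1, e2]; ring
  · left
    have e1 : X θ v = X θ u := by linarith
    have e2 : X θ a = X θ u := by linarith
    rw [e1, e2]; ring

lemma OnChain.cr_le_of_proj_eq (h : OnChain P u v θ a) (h' : OnChain P u v θ' b)
    (hp : proj u v a = proj u v b) : cr (v - u) (b - u) ≤ cr (v - u) (a - u) := by
  rcases h'.cr_eq_zero_or_strict with h0 | ⟨hx, hy⟩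
  · rw [h0]; exact h.cr_nonneg
  · by_contra hlt
    refine h.not_mem_quadrant h' ?_
    have e1 := proj_sub_proj θ' u v b a
    rw [hp, sub_self] at e1
    rw [cr_edge_eq θ', cr_edge_eq θ'] at hlt
    -- `a` is obtained from `b` by a step along the outward normal of the edge
    constructor
    · by_contra hc
      nlinarith [mul_pos (sub_pos.2 hx) (sub_pos.2 hy), sq_nonneg (X θ' v - X θ' u),
        sq_nonneg (Y θ' v - Y θ' u)]
    · by_contra hc
      nlinarith [mul_pos (sub_pos.2 hx) (sub_pos.2 hy), sq_nonneg (X θ' v - X θ' u),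
        sq_nonneg (Y θ' v - Y θ' u)]

/-- A subchain is a graph over its edge. -/
lemma proj_injOn (he : IsHullEdge P u v) : Set.InjOn (proj u v) (subchain P u v) := by
  intro a ha b hb hab
  obtain ⟨θ, h⟩ := exists_onChain he ha
  obtain ⟨θ', h'⟩ := exists_onChain he hb
  have h1 := le_antisymm (h'.cr_le_of_proj_eq h hab.symm) (h.cr_le_of_proj_eq h' hab)
  have h2 : proj u v b - proj u v a = 0 := by rw [hab, sub_self]
  have hne : 0 < dt (v - u) (v - u) := dt_self_pos (sub_ne_zero.2 he.2.2.1.symm)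
  rw [proj_eq, proj_eq] at h2
  simp only [cr, dt, PiLp.sub_apply] at h1 h2 hne
  ext i
  fin_cases i
  · show a 0 = b 0
    apply mul_left_cancel₀ hne.ne'
    linear_combination (-(v 0 - u 0)) * h2 - (v 1 - u 1) * h1
  · show a 1 = b 1
    apply mul_left_cancel₀ hne.ne'
    linear_combination (-(v 1 - u 1)) * h2 + (v 0 - u 0) * h1

end Chain

/-! ### Hull edges -/

section Edges
variable {P : Finset Plane} {u v u' v' a b d : Plane} {θ θ' : ℝ}

lemma IsHullEdge.eq_or_eq_of_cr_eq_zero (hP : NoThreeCollinear P) (he : IsHullEdge P u v)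
    {w : Plane} (hw : w ∈ P) (h : cr (v - u) (w - u) = 0) : w = u ∨ w = v := by
  by_contra hc
  push Not at hc
  refine hP u he.1 v he.2.1 w hw he.2.2.1 (Ne.symm hc.1) (Ne.symm hc.2) ?_
  have hne : 0 < dt (v - u) (v - u) := dt_self_pos (sub_ne_zero.2 he.2.2.1.symm)
  rw [collinear_iff_of_mem (p₀ := u) (by simp)]
  refine ⟨v - u, ?_⟩
  intro p hp
  simp only [Set.mem_insert_iff, Set.mem_singleton_iff] at hp
  rcases hp with rfl | rfl | rfl
  · exact ⟨0, by simp⟩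
  · exact ⟨1, by simp⟩
  · refine ⟨dt (p - u) (v - u) / dt (v - u) (v - u), ?_⟩
    simp only [cr, dt, PiLp.sub_apply] at h hne ⊢
    ext i
    fin_cases i
    · simp only [Fin.zero_eta, PiLp.add_apply, PiLp.smul_apply, PiLp.sub_apply, vadd_eq_add,
        smul_eq_mul]
      rw [← sub_eq_iff_eq_add, div_mul_eq_mul_div, eq_div_iff hne.ne']
      linear_combination (-(v 1 - u 1)) * h
    · simp only [Fin.mk_one, PiLp.add_apply, PiLp.smul_apply, PiLp.sub_apply, vadd_eq_add,
        smul_eq_mul]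
      rw [← sub_eq_iff_eq_add, div_mul_eq_mul_div, eq_div_iff hne.ne']
      linear_combination (v 0 - u 0) * h

/-- Seen in direction `d`, the hull edges facing that direction have disjoint interiors: two of
them that meet a common line parallel to `d` in their relative interiors coincide. Each of the two
edges is, along that line, not beyond the other one, so the meeting points agree. -/
lemma IsHullEdge.eq_of_overlap (hP : NoThreeCollinear P) (he : IsHullEdge P u v)
    (he' : IsHullEdge P u' v') {t : ℝ} (h1 : cr d u < t) (h2 : t < cr d v)
    (h1' : cr d u' < t) (h2' : t < cr d v') : u = u' ∧ v = v' := by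
  have a1 := he.cr_nonneg he'.1
  have a2 := he.cr_nonneg he'.2.1
  have b1 := he'.cr_nonneg he.1
  have b2 := he'.cr_nonneg he.2.1
  have key : (cr d v' - t) * cr (v - u) (u' - u) + (t - cr d u') * cr (v - u) (v' - u) +
      ((cr d v - t) * cr (v' - u') (u - u') + (t - cr d u) * cr (v' - u') (v - u')) = 0 := by
    simp only [cr, PiLp.sub_apply]; ring
  have z1 := mul_nonneg (sub_pos.2 h2').le a1
  have z2 := mul_nonneg (sub_pos.2 h1').le a2
  have z3 := mul_nonneg (sub_pos.2 h2).le b1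
  have z4 := mul_nonneg (sub_pos.2 h1).le b2
  have e1 : cr (v - u) (u' - u) = 0 := by
    have : (cr d v' - t) * cr (v - u) (u' - u) = 0 := by linarith
    exact (mul_eq_zero.1 this).resolve_left (sub_pos.2 h2').ne'
  have e2 : cr (v - u) (v' - u) = 0 := by
    have : (t - cr d u') * cr (v - u) (v' - u) = 0 := by linarith
    exact (mul_eq_zero.1 this).resolve_left (sub_pos.2 h1').ne'
  rcases he.eq_or_eq_of_cr_eq_zero hP he'.1 e1 with rfl | rfl
  · rcases he.eq_or_eq_of_cr_eq_zero hP he'.2.1 e2 with rfl | rfl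
    · exact absurd rfl he'.2.2.1
    · exact ⟨rfl, rfl⟩
  · exact absurd (h1'.trans h2) (lt_irrefl _)

/-- The two arms of a quadrant on a chain separate the end points of the edge. -/
lemma OnChain.lt_cr_tgt (h : OnChain P u v θ a) (hd : InCone θ d) (ha : a ≠ v) :
    cr d a < cr d v := by
  obtain ⟨-, -, b1, b2, b3, b4⟩ := h
  rw [← sub_pos, ← cr_sub_right, cr_eq θ, X_sub, Y_sub]
  by_cases hx : X θ v = X θ a
  · have hy : Y θ a < Y θ v := lt_of_le_of_ne b4 fun hy => ha (eq_of_X_Y θ hx.symm hy)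
    rw [hx]
    have := mul_pos hd.1 (sub_pos.2 hy)
    linarith
  · have := mul_pos hd.2 (sub_pos.2 (lt_of_le_of_ne b1 hx))
    have := mul_nonneg hd.1.le (sub_nonneg.2 b4)
    linarith

lemma OnChain.cr_src_lt (h : OnChain P u v θ a) (hd : InCone θ d) (ha : a ≠ u) :
    cr d u < cr d a := by
  obtain ⟨-, -, b1, b2, b3, b4⟩ := h
  rw [← sub_pos, ← cr_sub_right, cr_eq θ, X_sub, Y_sub]
  by_cases hx : X θ a = X θ u
  · have hy : Y θ u < Y θ a := lt_of_le_of_ne b3 fun hy => ha (eq_of_X_Y θ hx hy.symm)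
    rw [hx]
    have := mul_pos hd.1 (sub_pos.2 hy)
    linarith
  · have := mul_pos hd.2 (sub_pos.2 (lt_of_le_of_ne b2 hx))
    have := mul_nonneg hd.1.le (sub_nonneg.2 b3)
    linarith

/-- Quadrants with the same apex that belong to different edges have no direction in common. -/
lemma OnChain.edge_eq (hP : NoThreeCollinear P) (h : OnChain P u v θ a)
    (h' : OnChain P u' v' θ' a) (hd : InCone θ d) (hd' : InCone θ' d)
    (h1 : a ≠ u) (h2 : a ≠ v) (h3 : a ≠ u') (h4 : a ≠ v') : u = u' ∧ v = v' :=
  h.1.eq_of_overlap hP h'.1 (h.cr_src_lt hd h1) (h.lt_cr_tgt hd h2) (h'.cr_src_lt hd' h3)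
    (h'.lt_cr_tgt hd' h4)

lemma OnChain.ne_src (h : OnChain P u v θ a) (ha : a ∉ P) : a ≠ u :=
  fun e => ha (e ▸ h.1.1)

lemma OnChain.ne_tgt (h : OnChain P u v θ a) (ha : a ∉ P) : a ≠ v :=
  fun e => ha (e ▸ h.1.2.1)

/-- Along a subchain, the order by projections on the edge agrees with the order transverse to a
direction `d`, as long as the quadrants contain `d`. -/
lemma OnChain.cr_lt_of_proj_lt (h : OnChain P u v θ a) (h' : OnChain P u v θ' b)
    (hd : InCone θ d) (hd' : InCone θ' d) (hp : proj u v a < proj u v b) : cr d a < cr d b := by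
  have n1 := h'.not_mem_quadrant h
  have n2 := h.not_mem_quadrant h'
  have e1 := proj_sub_proj θ u v a b
  have e2 := proj_sub_proj θ' u v a b
  obtain ⟨-, -, b1, b2, b3, b4⟩ := h
  obtain ⟨-, -, c1, c2, c3, c4⟩ := h'
  have hX : X θ b ≤ X θ a := by
    by_contra hc
    have : Y θ b ≤ Y θ a := not_lt.1 fun hy => n1 ⟨not_le.1 hc, hy⟩
    nlinarith
  have hY : Y θ' a ≤ Y θ' b := by
    by_contra hc
    have : X θ' a ≤ X θ' b := not_lt.1 fun hx => n2 ⟨hx, not_le.1 hc⟩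
    nlinarith
  have hne : a ≠ b := fun e => by rw [e] at hp; exact lt_irrefl _ hp
  by_cases hYb : Y θ a ≤ Y θ b
  · rw [← sub_pos, ← cr_sub_right, cr_eq θ, X_sub, Y_sub]
    by_cases hx : X θ a = X θ b
    · have hy := lt_of_le_of_ne hYb fun hy => hne (eq_of_X_Y θ hx hy)
      have := mul_pos hd.1 (sub_pos.2 hy)
      rw [hx]; linarith
    · have := mul_pos hd.2 (sub_pos.2 (lt_of_le_of_ne hX (Ne.symm hx)))
      have := mul_nonneg hd.1.le (sub_nonneg.2 hYb)
      linarith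
  · by_cases hXb : X θ' b ≤ X θ' a
    · rw [← sub_pos, ← cr_sub_right, cr_eq θ', X_sub, Y_sub]
      by_cases hx : X θ' a = X θ' b
      · have hy := lt_of_le_of_ne hY fun hy => hne (eq_of_X_Y θ' hx hy)
        have := mul_pos hd'.1 (sub_pos.2 hy)
        rw [hx]; linarith
      · have := mul_pos hd'.2 (sub_pos.2 (lt_of_le_of_ne hXb (Ne.symm hx)))
        have := mul_nonneg hd'.1.le (sub_nonneg.2 hY)
        linarith
    · -- otherwise `b - a` points backwards in one frame and forwards in the other one
      exfalso
      have f1 : dt (b - a) d < 0 := by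
        rw [dt_eq θ, X_sub, Y_sub]
        have := mul_pos hd.2 (sub_pos.2 (not_le.1 hYb))
        have := mul_nonneg hd.1.le (sub_nonneg.2 hX)
        linarith
      have f2 : 0 < dt (b - a) d := by
        rw [dt_eq θ', X_sub, Y_sub]
        have := mul_pos hd'.1 (sub_pos.2 (not_le.1 hXb))
        have := mul_nonneg hd'.2.le (sub_nonneg.2 hY)
        linarith
      linarith

/-- If the line through `a` in the direction `d` of its quadrant moves towards larger values of
`⟨δ, ·⟩`, then the edge reaches higher than `a`. -/
lemma OnChain.dt_lt_tgt (h : OnChain P u v θ a) (ha : a ∉ P) (hd : InCone θ d) {δ : Plane}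
    (hδ : 0 ≤ dt d δ) (huv : dt u δ < dt v δ) : dt a δ < dt v δ := by
  have c1 := h.cr_src_lt hd (h.ne_src ha)
  have c2 := h.lt_cr_tgt hd (h.ne_tgt ha)
  have h0 := h.cr_nonneg
  -- the line meets the edge in the point dividing it in the ratio of these two positive numbers
  have key : (cr d v - cr d a) * (dt u δ - dt a δ) + (cr d a - cr d u) * (dt v δ - dt a δ) =
      cr (v - u) (a - u) * dt d δ := by
    simp only [cr, dt, PiLp.sub_apply]; ring
  have := mul_nonneg h0 hδ
  by_contra hc
  have k1 : (cr d v - cr d a) * (dt u δ - dt a δ) < 0 :=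
    mul_neg_of_pos_of_neg (sub_pos.2 c2) (by linarith)
  have k2 : (cr d a - cr d u) * (dt v δ - dt a δ) ≤ 0 :=
    mul_nonpos_of_nonneg_of_nonpos (sub_pos.2 c1).le (by linarith)
  linarith

lemma OnChain.src_lt_dt (h : OnChain P u v θ a) (ha : a ∉ P) (hd : InCone θ d) {δ : Plane}
    (hδ : dt d δ ≤ 0) (huv : dt u δ < dt v δ) : dt u δ < dt a δ := by
  have c1 := h.cr_src_lt hd (h.ne_src ha)
  have c2 := h.lt_cr_tgt hd (h.ne_tgt ha)
  have h0 := h.cr_nonneg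
  have key : (cr d v - cr d a) * (dt u δ - dt a δ) + (cr d a - cr d u) * (dt v δ - dt a δ) =
      cr (v - u) (a - u) * dt d δ := by
    simp only [cr, dt, PiLp.sub_apply]; ring
  have := mul_nonpos_of_nonneg_of_nonpos h0 hδ
  by_contra hc
  have k1 : 0 ≤ (cr d v - cr d a) * (dt u δ - dt a δ) :=
    mul_nonneg (sub_pos.2 c2).le (by linarith)
  have k2 : 0 < (cr d a - cr d u) * (dt v δ - dt a δ) :=
    mul_pos (sub_pos.2 c1) (by linarith)
  linarith

end Edges

/-! ### Links -/

section Links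
variable {P : Finset Plane}

lemma Link.eq_fst_or_eq_snd (L : Link P) {z : Plane} (hz : z ∈ L.carrier) (hzP : z ∈ P) :
    z = L.fst ∨ z = L.snd := by
  rcases L.consecutive z hzP hz.1 with h | h
  · exact Or.inl (proj_injOn L.isHullEdge hz.1 L.fst_mem_subchain (le_antisymm h hz.2.1))
  · exact Or.inr (proj_injOn L.isHullEdge hz.1 L.snd_mem_subchain (le_antisymm hz.2.2 h))

lemma Link.proj_lt (L : Link P) {z : Plane} (hz : z ∈ L.carrier) (hzP : z ∉ P) :
    proj L.src L.tgt L.fst < proj L.src L.tgt z ∧ proj L.src L.tgt z < proj L.src L.tgt L.snd := by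
  refine ⟨lt_of_le_of_ne hz.2.1 fun h => hzP ?_, lt_of_le_of_ne hz.2.2 fun h => hzP ?_⟩
  · rw [← proj_injOn L.isHullEdge L.fst_mem_subchain hz.1 h]; exact L.fst_mem
  · rw [proj_injOn L.isHullEdge hz.1 L.snd_mem_subchain h]; exact L.snd_mem

/-- Two links of the same subchain are equal or lie in order along the edge. -/
lemma Link.eq_or_le_or_le {L M : Link P} (h : L.SameSubchain M) : L = M ∨
    proj L.src L.tgt L.snd ≤ proj L.src L.tgt M.fst ∨
    proj L.src L.tgt M.snd ≤ proj L.src L.tgt L.fst := by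
  obtain ⟨u, v, f1, s1, he1, f1P, s1P, f1c, s1c, lt1, c1⟩ := L
  obtain ⟨u', v', f2, s2, he2, f2P, s2P, f2c, s2c, lt2, c2⟩ := M
  obtain ⟨rfl, rfl⟩ := h
  simp only at *
  have inj := proj_injOn he1
  rcases c1 f2 f2P f2c with h1 | h1
  · rcases c1 s2 s2P s2c with h2 | h2
    · exact Or.inr (Or.inr h2)
    · rcases c2 f1 f1P f1c with h3 | h3
      · rcases c2 s1 s1P s1c with h4 | h4
        · linarith
        · have e1 := inj f1c f2c (le_antisymm h3 h1)
          have e2 := inj s1c s2c (le_antisymm h2 h4)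
          subst e1 e2
          exact Or.inl rfl
      · exact Or.inr (Or.inr h3)
  · exact Or.inr (Or.inl h1)

/-- Distinct links of the same subchain meet only in a common end point. -/
lemma Link.common_of_sameSubchain {L M : Link P} (hne : L ≠ M) (h : L.SameSubchain M) {z : Plane}
    (hL : z ∈ L.carrier) (hM : z ∈ M.carrier) :
    (L.snd = M.fst ∧ z = L.snd) ∨ (L.fst = M.snd ∧ z = L.fst) := by
  have inj := proj_injOn L.isHullEdge
  have hM1 := hM.2.1
  have hM2 := hM.2.2
  have hf := M.fst_mem_subchain
  have hs := M.snd_mem_subchain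
  rw [← h.1, ← h.2] at hM1 hM2 hf hs
  rcases Link.eq_or_le_or_le h with h1 | h1 | h1
  · exact absurd h1 hne
  · left
    have := hL.2.2
    exact ⟨inj L.snd_mem_subchain hf (by linarith), inj hL.1 L.snd_mem_subchain (by linarith)⟩
  · right
    have := hL.2.1
    exact ⟨inj L.fst_mem_subchain hs (by linarith), inj hL.1 L.fst_mem_subchain (by linarith)⟩

/-- The point `z`, not in `P`, lies on the link `L`, as witnessed by a quadrant containing the
direction `d`. -/
def Visits (L : Link P) (d z : Plane) : Prop :=
  z ∈ L.carrier ∧ z ∉ P ∧ ∃ θ, OnChain P L.src L.tgt θ z ∧ InCone θ d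

/-- Transversally to `d`, the points visited by one link are all on the same side of
a point visited by another link. -/
lemma Visits.separated (hP : NoThreeCollinear P) {L M : Link P} (hne : L ≠ M) {d z z' w : Plane}
    (h : Visits L d z) (h' : Visits L d z') (hw : Visits M d w) :
    (cr d z < cr d w ∧ cr d z' < cr d w) ∨ (cr d w < cr d z ∧ cr d w < cr d z') := by
  obtain ⟨c, n, θ, o, hd⟩ := h
  obtain ⟨c', n', θ', o', hd'⟩ := h'
  obtain ⟨cw, nw, θw, ow, hdw⟩ := hw
  by_cases hs : L.SameSubchain M
  · have p1 := L.proj_lt c n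
    have p2 := L.proj_lt c' n'
    have p3 := M.proj_lt cw nw
    rw [← hs.1, ← hs.2] at ow p3
    rcases Link.eq_or_le_or_le hs with h1 | h1 | h1
    · exact absurd h1 hne
    · exact Or.inl ⟨o.cr_lt_of_proj_lt ow hd hdw (by linarith),
        o'.cr_lt_of_proj_lt ow hd' hdw (by linarith)⟩
    · exact Or.inr ⟨ow.cr_lt_of_proj_lt o hdw hd (by linarith),
        ow.cr_lt_of_proj_lt o' hdw hd' (by linarith)⟩
  · have a1 := o.cr_src_lt hd (o.ne_src n)
    have a2 := o.lt_cr_tgt hd (o.ne_tgt n)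
    have b1 := o'.cr_src_lt hd' (o'.ne_src n')
    have b2 := o'.lt_cr_tgt hd' (o'.ne_tgt n')
    have w1 := ow.cr_src_lt hdw (ow.ne_src nw)
    have w2 := ow.lt_cr_tgt hdw (ow.ne_tgt nw)
    have key : cr d L.tgt ≤ cr d M.src ∨ cr d M.tgt ≤ cr d L.src := by
      by_contra hc
      push Not at hc
      obtain ⟨t, ht1, ht2⟩ := exists_between (a₁ := max (cr d L.src) (cr d M.src))
        (a₂ := min (cr d L.tgt) (cr d M.tgt))
        (max_lt (lt_min (by linarith) hc.2) (lt_min hc.1 (by linarith)))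
      rw [max_lt_iff] at ht1
      rw [lt_min_iff] at ht2
      exact hs (o.1.eq_of_overlap hP ow.1 ht1.1 ht2.1 ht1.2 ht2.2)
    rcases key with k | k
    · exact Or.inl ⟨by linarith, by linarith⟩
    · exact Or.inr ⟨by linarith, by linarith⟩

end Links

/-! ### Links are concave arcs -/

section Concave
variable {P : Finset Plane} {u v a b c s t : Plane} {θ θ' : ℝ}

lemma OnChain.Y_le_of_proj_lt (h : OnChain P u v θ a) (hs : s ∉ quadrant θ a)
    (hp : proj u v s < proj u v a) : Y θ s ≤ Y θ a := by
  by_contra hc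
  have hx : X θ s ≤ X θ a := not_lt.1 fun hx => hs ⟨hx, not_le.1 hc⟩
  have e := proj_sub_proj θ u v s a
  obtain ⟨-, -, b1, b2, b3, b4⟩ := h
  nlinarith

lemma OnChain.X_le_of_lt_proj (h : OnChain P u v θ a) (ht : t ∉ quadrant θ a)
    (hp : proj u v a < proj u v t) : X θ t ≤ X θ a := by
  by_contra hc
  have hy : Y θ t ≤ Y θ a := not_lt.1 fun hy => ht ⟨not_le.1 hc, hy⟩
  have e := proj_sub_proj θ u v a t
  obtain ⟨-, -, b1, b2, b3, b4⟩ := h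
  nlinarith

/-- A point of `P` on one of the two bounding rays of a quadrant of the chain is itself a point of
the subchain. -/
lemma OnChain.support_mem (h : OnChain P u v θ b) (hb : b ∉ P) (hs : s ∈ P)
    (hs1 : (Y θ s = Y θ b ∧ X θ b < X θ s) ∨ (X θ s = X θ b ∧ Y θ b < Y θ s)) :
    s ∈ subchain P u v := by
  have hst := h.strict hb
  have h0 := h.1.cr_nonneg hs
  have hf := h.free
  obtain ⟨he, -, b1, b2, b3, b4⟩ := h
  rw [cr_edge_eq θ] at h0
  refine ⟨θ, Or.inr ⟨hs, fun p hp hq => hf p hp ?_⟩, ?_⟩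
  · rcases hs1 with ⟨e, l⟩ | ⟨e, l⟩
    · exact ⟨l.trans hq.1, e ▸ hq.2⟩
    · exact ⟨e ▸ hq.1, l.trans hq.2⟩
  · rcases hs1 with ⟨e, l⟩ | ⟨e, l⟩
    · refine ⟨by linarith, ?_, by linarith, by linarith⟩
      by_contra hc
      nlinarith [mul_pos (sub_pos.2 hst.2) (sub_pos.2 (not_le.1 hc))]
    · refine ⟨by linarith, by linarith, by linarith, ?_⟩
      by_contra hc
      nlinarith [mul_pos (sub_pos.2 hst.1) (sub_pos.2 (not_le.1 hc))]

/-- If a quadrant with apex at the origin separates `s` from `t`, then these two vectors are at least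
a right angle apart, provided that the angle from `s` to `t` is less than 180°. The last hypothesis,
which refers to a frame turned by at most a right angle, excludes that `s` and `t` are both behind
the apex. -/
lemma dt_nonpos_of_separated (hc : 0 ≤ Real.cos (θ' - θ)) (hs : Y θ s ≤ 0) (ht : X θ t ≤ 0)
    (hcr : 0 < cr s t) (h : (0 < X θ' s ∧ 0 ≤ Y θ' s) ∨ (0 ≤ X θ' t ∧ 0 < Y θ' t)) :
    dt s t ≤ 0 := by
  rw [dt_eq θ]
  rw [cr_eq θ] at hcr
  by_cases h1 : 0 ≤ X θ s
  · have h2 : 0 ≤ Y θ t := by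
      by_contra h2
      nlinarith
    nlinarith
  · exfalso
    have h2 : Y θ t < 0 := by
      by_contra h2
      nlinarith
    rw [not_le] at h1
    rw [X_rotate θ' θ] at h1 ht
    rw [Y_rotate θ' θ] at hs h2
    rcases h with ⟨k1, k2⟩ | ⟨k1, k2⟩
    · have : 0 < Real.sin (θ' - θ) := by
        by_contra hn
        nlinarith
      nlinarith
    · have : Real.sin (θ' - θ) < 0 := by
        by_contra hn
        nlinarith
      nlinarith

/-- Let `a`, `b`, `c` be points of a link in this order. The quadrant at `b` separates `a` from `c`,
and there is a direction `g` in it that makes acute angles with `a - b` and `c - b`.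

For `g` one can take the normal of the circle through `b` that has the two points of `P` supporting
the quadrant at `b` as antipodal points: these two points lie beyond the ends of the link, so
the quadrants at `a` and `c` separate them, too, which puts `a` and `c` in the disk. -/
lemma Link.exists_middle (L : Link P) (ha : a ∈ L.carrier) (hb : b ∈ L.carrier)
    (hc : c ∈ L.carrier) (hab : proj L.src L.tgt a < proj L.src L.tgt b)
    (hbc : proj L.src L.tgt b < proj L.src L.tgt c) :
    b ∉ P ∧ ∃ θ g, OnChain P L.src L.tgt θ b ∧ InCone θ g ∧ 0 < dt g (a - b) ∧
      0 < dt g (c - b) ∧ Y θ (a - b) ≤ 0 ∧ X θ (c - b) ≤ 0 := by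
  have hbP : b ∉ P := by
    intro hbP
    rcases L.consecutive b hbP hb.1 with h | h
    · exact absurd ha.2.1 (by linarith)
    · exact absurd hc.2.2 (by linarith)
  refine ⟨hbP, ?_⟩
  obtain ⟨θ, o⟩ := exists_onChain L.isHullEdge hb.1
  obtain ⟨-, ⟨p, hp, hp1, hp2⟩, ⟨q, hq, hq1, hq2⟩⟩ := o.extremal hbP
  have pc := o.support_mem hbP hp (Or.inl ⟨hp1, hp2⟩)
  have qc := o.support_mem hbP hq (Or.inr ⟨hq1, hq2⟩)
  have hst := o.strict hbP
  have inj := proj_injOn L.isHullEdge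
  have pb : proj L.src L.tgt p < proj L.src L.tgt b := by
    have e := proj_sub_proj θ L.src L.tgt b p
    rw [hp1] at e
    nlinarith [mul_pos (sub_pos.2 hst.1) (sub_pos.2 hp2)]
  have bq : proj L.src L.tgt b < proj L.src L.tgt q := by
    have e := proj_sub_proj θ L.src L.tgt b q
    rw [hq1] at e
    nlinarith [mul_pos (sub_pos.2 hst.2) (sub_pos.2 hq2)]
  have pf : proj L.src L.tgt p ≤ proj L.src L.tgt L.fst :=
    (L.consecutive p hp pc).resolve_right (by have := hb.2.2; linarith)
  have qs : proj L.src L.tgt L.snd ≤ proj L.src L.tgt q :=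
    (L.consecutive q hq qc).resolve_left (by have := hb.2.1; linarith)
  obtain ⟨θa, oa⟩ := exists_onChain L.isHullEdge ha.1
  obtain ⟨θc, oc⟩ := exists_onChain L.isHullEdge hc.1
  have Ya := o.Y_le_of_proj_lt (oa.not_mem_quadrant o) hab
  have Xc := o.X_le_of_lt_proj (oc.not_mem_quadrant o) hbc
  have XX : X θ (p - b + (q - b)) = X θ p - X θ b := by
    simp only [X, PiLp.sub_apply, PiLp.add_apply] at hq1 ⊢; linarith
  have YY : Y θ (p - b + (q - b)) = Y θ q - Y θ b := by
    simp only [Y, PiLp.sub_apply, PiLp.add_apply] at hp1 ⊢; linarith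
  -- membership in the disk with diameter `p q`, rewritten as a half-plane condition
  have disk : ∀ z, z ≠ b → dt (p - z) (q - z) ≤ 0 → 0 < dt (p - b + (q - b)) (z - b) := by
    intro z hz h
    have hz' := dt_self_pos (sub_ne_zero.2 hz)
    rw [dt_eq θ] at h hz' ⊢
    rw [XX, YY]
    simp only [X_sub, Y_sub] at h hz' ⊢
    rw [hp1, hq1] at h
    nlinarith
  have hcr : ∀ z, cr (p - z) (q - z) = (X θ p - X θ b) * (Y θ q - Y θ b) -
      (X θ p - X θ b) * (Y θ z - Y θ b) - (Y θ q - Y θ b) * (X θ z - X θ b) := by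
    intro z
    rw [cr_eq θ]; simp only [X_sub, Y_sub]; rw [hp1, hq1]; ring
  refine ⟨θ, p - b + (q - b), o, ⟨?_, ?_⟩, disk a ?_ ?_, disk c ?_ ?_, ?_, ?_⟩
  · rw [XX]; linarith
  · rw [YY]; linarith
  · rintro rfl; exact lt_irrefl _ hab
  · by_cases hpa : p = a
    · simp [hpa, dt]
    have hlt : proj L.src L.tgt p < proj L.src L.tgt a :=
      lt_of_le_of_ne (pf.trans ha.2.1) fun e => hpa (inj pc ha.1 e)
    have hXa : X θ a < X θ p := by
      have e := proj_sub_proj θ L.src L.tgt p a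
      rw [hp1] at e
      by_contra hn
      nlinarith [mul_nonneg (sub_pos.2 hst.1).le (sub_nonneg.2 (not_lt.1 hn)),
        mul_nonneg (sub_pos.2 hst.2).le (sub_nonneg.2 Ya)]
    refine dt_nonpos_of_separated (θ := θa) (θ' := θ)
      (IsBetween.cos_nonneg o.1.2.2.1 o.2.2 oa.2.2) ?_ ?_ ?_ (Or.inl ⟨?_, ?_⟩)
    · rw [Y_sub]
      linarith [oa.Y_le_of_proj_lt (oa.free p hp) hlt]
    · rw [X_sub]
      linarith [oa.X_le_of_lt_proj (oa.free q hq) (by linarith)]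
    · rw [hcr]
      nlinarith [mul_pos (sub_pos.2 hq2) (sub_pos.2 hXa),
        mul_nonneg (sub_pos.2 hp2).le (sub_nonneg.2 Ya)]
    · rw [X_sub]; linarith
    · rw [Y_sub]; linarith
  · rintro rfl; exact lt_irrefl _ hbc
  · by_cases hqc : q = c
    · simp [hqc, dt]
    have hlt : proj L.src L.tgt c < proj L.src L.tgt q :=
      lt_of_le_of_ne (hc.2.2.trans qs) fun e => hqc (inj qc hc.1 e.symm)
    have hYc : Y θ c < Y θ q := by
      have e := proj_sub_proj θ L.src L.tgt c q
      rw [hq1] at e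
      by_contra hn
      nlinarith [mul_nonneg (sub_pos.2 hst.2).le (sub_nonneg.2 (not_lt.1 hn)),
        mul_nonneg (sub_pos.2 hst.1).le (sub_nonneg.2 Xc)]
    refine dt_nonpos_of_separated (θ := θc) (θ' := θ)
      (IsBetween.cos_nonneg o.1.2.2.1 o.2.2 oc.2.2) ?_ ?_ ?_ (Or.inr ⟨?_, ?_⟩)
    · rw [Y_sub]
      linarith [oc.Y_le_of_proj_lt (oc.free p hp) (by linarith)]
    · rw [X_sub]
      linarith [oc.X_le_of_lt_proj (oc.free q hq) hlt]
    · rw [hcr]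
      nlinarith [mul_pos (sub_pos.2 hp2) (sub_pos.2 hYc),
        mul_nonneg (sub_pos.2 hq2).le (sub_nonneg.2 Xc)]
    · rw [X_sub]; linarith
    · rw [Y_sub]; linarith
  · rw [Y_sub]; linarith
  · rw [X_sub]; linarith

/-- The sign conditions that follow when a quadrant separates `s` from `t` and contains a direction
`g` with positive scalar products. -/
lemma InCone.separated {g : Plane} (hg : InCone θ g) (hs : 0 < dt g s) (ht : 0 < dt g t)
    (hYs : Y θ s ≤ 0) (hXt : X θ t ≤ 0) :
    0 < X θ s ∧ 0 < Y θ t ∧ 0 < cr s t ∧ dt s t ≤ 0 := by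
  rw [dt_eq θ] at hs ht
  rw [dt_eq θ, cr_eq θ]
  obtain ⟨g1, g2⟩ := hg
  have h1 : 0 < X θ s := by
    by_contra hn
    nlinarith
  have h2 : 0 < Y θ t := by
    by_contra hn
    nlinarith
  refine ⟨h1, h2, ?_, by nlinarith⟩
  have k1 : X θ g * (X θ s * Y θ t - Y θ s * X θ t) =
      Y θ t * (X θ g * X θ s + Y θ g * Y θ s) - Y θ s * (X θ g * X θ t + Y θ g * Y θ t) := by ring
  have k2 : 0 < X θ g * (X θ s * Y θ t - Y θ s * X θ t) := by
    rw [k1]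
    nlinarith [mul_pos h2 hs, mul_nonneg (neg_nonneg.2 hYs) ht.le]
  exact (mul_pos_iff_of_pos_left g1).1 k2

lemma Link.dt_middle_nonpos (L : Link P) (ha : a ∈ L.carrier) (hb : b ∈ L.carrier)
    (hc : c ∈ L.carrier) (hab : proj L.src L.tgt a < proj L.src L.tgt b)
    (hbc : proj L.src L.tgt b < proj L.src L.tgt c) : dt (a - b) (c - b) ≤ 0 := by
  obtain ⟨-, θ, g, -, hg, h1, h2, h3, h4⟩ := L.exists_middle ha hb hc hab hbc
  exact (hg.separated h1 h2 h3 h4).2.2.2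

/-- Three points in the same order on two links of different subchains are impossible: the
direction `g` belonging to the middle point and the first link also lies in the quadrant
belonging to the second link. -/
lemma Link.not_same_order (hP : NoThreeCollinear P) {L M : Link P} (h : ¬ L.SameSubchain M)
    (ha : a ∈ L.carrier) (hb : b ∈ L.carrier) (hc : c ∈ L.carrier)
    (ha' : a ∈ M.carrier) (hb' : b ∈ M.carrier) (hc' : c ∈ M.carrier)
    (hab : proj L.src L.tgt a < proj L.src L.tgt b) (hbc : proj L.src L.tgt b < proj L.src L.tgt c)
    (hab' : proj M.src M.tgt a < proj M.src M.tgt b)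
    (hbc' : proj M.src M.tgt b < proj M.src M.tgt c) : False := by
  obtain ⟨hbP, θ, g, o, hg, h1, h2, h3, h4⟩ := L.exists_middle ha hb hc hab hbc
  obtain ⟨-, θ', g', o', hg', h1', h2', h3', h4'⟩ := M.exists_middle ha' hb' hc' hab' hbc'
  obtain ⟨k1, k2, k3, -⟩ := hg'.separated h1' h2' h3' h4'
  refine h (o.edge_eq hP o' hg ?_ (o.ne_src hbP) (o.ne_tgt hbP) (o'.ne_src hbP) (o'.ne_tgt hbP))
  rw [cr_eq θ'] at k3
  rw [dt_eq θ'] at h1 h2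
  constructor
  · refine (mul_pos_iff_of_pos_right k3).1 ?_
    have := mul_pos k2 h1
    have := mul_nonneg (neg_nonneg.2 h3') h2.le
    linarith
  · refine (mul_pos_iff_of_pos_right k3).1 ?_
    have := mul_pos k1 h2
    have := mul_nonneg (neg_nonneg.2 h4') h1.le
    linarith

lemma Link.not_opposite_order {L M : Link P}
    (ha : a ∈ L.carrier) (hb : b ∈ L.carrier) (hc : c ∈ L.carrier)
    (ha' : a ∈ M.carrier) (hb' : b ∈ M.carrier) (hc' : c ∈ M.carrier)
    (hab : proj L.src L.tgt a < proj L.src L.tgt b) (hbc : proj L.src L.tgt b < proj L.src L.tgt c)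
    (hab' : proj M.src M.tgt b < proj M.src M.tgt a)
    (hbc' : proj M.src M.tgt c < proj M.src M.tgt b) : False := by
  obtain ⟨-, θ, g, -, hg, h1, h2, h3, h4⟩ := L.exists_middle ha hb hc hab hbc
  obtain ⟨-, θ', g', -, hg', h1', h2', h3', h4'⟩ := M.exists_middle hc' hb' ha' hbc' hab'
  have k := (hg.separated h1 h2 h3 h4).2.2.1
  have k' := (hg'.separated h1' h2' h3' h4').2.2.1
  simp only [cr, PiLp.sub_apply] at k k'
  linarith

/-- A triangle has no two angles that are right or obtuse. -/
lemma not_two_dt_nonpos (hab : a ≠ b) (h : dt (a - b) (c - b) ≤ 0) (h' : dt (b - a) (c - a) ≤ 0) :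
    False := by
  have := dt_self_pos (sub_ne_zero.2 hab)
  simp only [dt, PiLp.sub_apply] at *
  nlinarith

lemma dt_comm (a b : Plane) : dt a b = dt b a := by simp only [dt]; ring

/-- Three points that are in order on one link are not all on a link of another subchain: in a
triangle only one angle can be right or obtuse, so the same point is in the middle on both links. -/
lemma Link.not_three_common (hP : NoThreeCollinear P) {L M : Link P} (h : ¬ L.SameSubchain M)
    (ha : a ∈ L.carrier) (hb : b ∈ L.carrier) (hc : c ∈ L.carrier)
    (ha' : a ∈ M.carrier) (hb' : b ∈ M.carrier) (hc' : c ∈ M.carrier)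
    (hab : proj L.src L.tgt a < proj L.src L.tgt b)
    (hbc : proj L.src L.tgt b < proj L.src L.tgt c) : False := by
  have inj := proj_injOn M.isHullEdge
  have nab : a ≠ b := by rintro rfl; exact lt_irrefl _ hab
  have nbc : b ≠ c := by rintro rfl; exact lt_irrefl _ hbc
  have nac : a ≠ c := by rintro rfl; exact lt_asymm hab hbc
  have D := L.dt_middle_nonpos ha hb hc hab hbc
  have key : dt (b - a) (c - a) ≤ 0 → False := not_two_dt_nonpos nab D
  have key' : dt (b - c) (a - c) ≤ 0 → False :=
    not_two_dt_nonpos nbc.symm (by rw [dt_comm]; exact D)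
  rcases lt_or_gt_of_ne (fun e => nab (inj ha'.1 hb'.1 e)) with h1 | h1 <;>
  rcases lt_or_gt_of_ne (fun e => nbc (inj hb'.1 hc'.1 e)) with h2 | h2 <;>
  rcases lt_or_gt_of_ne (fun e => nac (inj ha'.1 hc'.1 e)) with h3 | h3
  · exact Link.not_same_order hP h ha hb hc ha' hb' hc' hab hbc h1 h2
  · exact Link.not_same_order hP h ha hb hc ha' hb' hc' hab hbc h1 h2
  · exact key' (by rw [dt_comm]; exact M.dt_middle_nonpos ha' hc' hb' h3 h2)
  · exact key (by rw [dt_comm]; exact M.dt_middle_nonpos hc' ha' hb' h3 h1)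
  · exact key (M.dt_middle_nonpos hb' ha' hc' h1 h3)
  · exact key' (M.dt_middle_nonpos hb' hc' ha' h2 h3)
  · exact Link.not_opposite_order ha hb hc ha' hb' hc' hab hbc h1 h2
  · exact Link.not_opposite_order ha hb hc ha' hb' hc' hab hbc h1 h2

/-- Links of different subchains have at most two common points. -/
lemma Link.encard_inter_le_two (hP : NoThreeCollinear P) {L M : Link P} (h : ¬ L.SameSubchain M) :
    (L.carrier ∩ M.carrier).encard ≤ 2 := by
  by_contra hn
  have h3 : (3 : ℕ∞) ≤ (L.carrier ∩ M.carrier).encard := by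
    have := Order.add_one_le_of_lt (not_le.1 hn)
    norm_num at this
    exact this
  obtain ⟨s, hs, hs3⟩ := Set.exists_subset_encard_eq h3
  obtain ⟨a, b, c, nab, nac, nbc, rfl⟩ := Set.encard_eq_three.1 hs3
  obtain ⟨ha, ha'⟩ := hs (show a ∈ _ by simp)
  obtain ⟨hb, hb'⟩ := hs (show b ∈ _ by simp)
  obtain ⟨hc, hc'⟩ := hs (show c ∈ _ by simp)
  have inj := proj_injOn L.isHullEdge
  rcases lt_or_gt_of_ne (fun e => nab (inj ha.1 hb.1 e)) with h1 | h1 <;>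
  rcases lt_or_gt_of_ne (fun e => nbc (inj hb.1 hc.1 e)) with h2 | h2 <;>
  rcases lt_or_gt_of_ne (fun e => nac (inj ha.1 hc.1 e)) with h3 | h3
  · exact Link.not_three_common hP h ha hb hc ha' hb' hc' h1 h2
  · exact Link.not_three_common hP h ha hb hc ha' hb' hc' h1 h2
  · exact Link.not_three_common hP h ha hc hb ha' hc' hb' h3 h2
  · exact Link.not_three_common hP h hc ha hb hc' ha' hb' h3 h1
  · exact Link.not_three_common hP h hb ha hc hb' ha' hc' h1 h3
  · exact Link.not_three_common hP h hb hc ha hb' hc' ha' h2 h3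
  · exact Link.not_three_common hP h hc hb ha hc' hb' ha' h2 h1
  · exact Link.not_three_common hP h hc hb ha hc' hb' ha' h2 h1

end Concave

/-! ### Crossings of links transverse to two fixed directions -/

section Crossings
variable {P : Finset Plane}

lemma cone_inequalities {p q x y a b : ℝ} (hp : 0 < p) (hq : 0 < q) (he : ¬ (0 < a ∧ 0 < b))
    (hε : ¬ (0 < x ∧ 0 < y)) (h1 : p * y - q * x < 0) (h2 : 0 ≤ p * b - q * a)
    (h3 : a * y - b * x < 0) : a * x + b * y ≤ 0 ∧ y ≤ 0 := by
  have hy : y ≤ 0 := by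
    by_contra hy
    have hx : x ≤ 0 := not_lt.1 fun hx => hε ⟨hx, not_le.1 hy⟩
    nlinarith
  have ha : a ≤ 0 := by
    by_contra ha
    have hb : b ≤ 0 := not_lt.1 fun hb => he ⟨not_le.1 ha, hb⟩
    nlinarith
  refine ⟨?_, hy⟩
  rcases le_or_gt 0 b with hb | hb
  · have hx : 0 ≤ x := by
      by_contra hx
      nlinarith
    nlinarith
  · exfalso
    have hx : x < 0 := by
      by_contra hx
      nlinarith
    have k1 : 0 < -x := by linarith
    have k2 : 0 < -b := by linarith
    -- slopes of `(p, q)`, `(-a, -b)` and `(-x, -y)` would increase cyclically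
    have m1 : q * (-x) * (-b) < p * (-y) * (-b) := by nlinarith
    have m2 : p * (-b) * (-y) ≤ q * (-a) * (-y) := by
      apply mul_le_mul_of_nonneg_right _ (by linarith)
      linarith
    have m3 : q * ((-a) * (-y)) ≤ q * ((-b) * (-x)) := by
      apply mul_le_mul_of_nonneg_left _ hq.le
      linarith
    linarith

/-- Let `e` be a direction outside a quadrant, on the side of the second axis from a direction
`d` inside it, and let `ε` be a vector outside the quadrant on the side of the first axis of
both of them. Then `e` and `ε` are at least a right angle apart, and `ε` is not above the first
axis. -/
lemma InCone.dt_nonpos_of_cr_neg {θ : ℝ} {d e ε : Plane} (hd : InCone θ d) (he : ¬ InCone θ e)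
    (hε : ¬ InCone θ ε) (h1 : cr d ε < 0) (h2 : 0 ≤ cr d e) (h3 : cr e ε < 0) :
    dt e ε ≤ 0 ∧ Y θ ε ≤ 0 := by
  rw [cr_eq θ] at h1 h2 h3
  rw [dt_eq θ]
  refine cone_inequalities hd.1 hd.2 he hε h1 h2 h3

/-- The mirror image of `InCone.dt_nonpos_of_cr_neg`. -/
lemma InCone.dt_nonpos_of_cr_pos {θ : ℝ} {d e ε : Plane} (hd : InCone θ d) (he : ¬ InCone θ e)
    (hε : ¬ InCone θ ε) (h1 : 0 < cr d ε) (h2 : cr d e ≤ 0) (h3 : 0 < cr e ε) :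
    dt e ε ≤ 0 ∧ X θ ε ≤ 0 := by
  rw [cr_eq θ] at h1 h2 h3
  rw [dt_eq θ]
  have := cone_inequalities hd.2 hd.1 (fun h => he ⟨h.2, h.1⟩) (fun h => hε ⟨h.2, h.1⟩)
    (show Y θ d * X θ ε - X θ d * Y θ ε < 0 by linarith)
    (show 0 ≤ Y θ d * X θ e - X θ d * Y θ e by linarith)
    (show Y θ e * X θ ε - X θ e * Y θ ε < 0 by linarith)
  exact ⟨by linarith [this.1], this.2⟩

/-- Suppose that `L` meets `M` in `z`, `M₂` in `z₂`, and that `L₂` meets `M` in `z₃`, where the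
quadrants for `L` and `L₂` contain `d` and those for `M` and `M₂` contain `d'`, which is clockwise
from `d`. Then it is impossible that, transversally to `d'`, the point `z₂` is weakly clockwise from
`z` and, transversally to `d`, the point `z₃` is weakly counterclockwise from `z`.

Otherwise `δ = z₃ - z₂` is at most a right angle from `d` and at least one from `d'`. With respect to
the height `⟨δ, ·⟩`, the edge of `L` starts below `z₂`, hence below `z₃`, and so below the end of
the edge of `M`. By way of `z`, the edge of `M` starts below the end of the edge of `L`. Both edges
are increasing on the boundary of the convex hull, so that the overlap of their heights
makes them equal. -/
lemma Visits.not_zigzag (hP : NoThreeCollinear P) {L L₂ M M₂ : Link P} {d d' z z₂ z₃ : Plane}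
    (hdd : 0 ≤ cr d' d) (hL : L₂ ≠ L) (hM : M₂ ≠ M)
    (hLM : ¬ L.SameSubchain M) (hLM₂ : ¬ L.SameSubchain M₂) (hL₂M : ¬ L₂.SameSubchain M)
    (h1 : Visits L d z) (h2 : Visits M d' z) (h3 : Visits L d z₂) (h4 : Visits M₂ d' z₂)
    (h5 : Visits L₂ d z₃) (h6 : Visits M d' z₃)
    (hz₂ : cr d' z₂ ≤ cr d' z) (hz₃ : cr d z ≤ cr d z₃) : False := by
  have A : cr d z₂ < cr d z₃ := by
    rcases h1.separated hP hL.symm h3 h5 with h | h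
    · exact h.2
    · exact absurd hz₃ (not_le.2 h.1)
  have B : cr d' z₂ < cr d' z₃ := by
    rcases h2.separated hP hM.symm h6 h4 with h | h
    · exact absurd hz₂ (not_le.2 h.1)
    · exact h.2
  obtain ⟨-, n, ψ, o1, k1⟩ := h1
  obtain ⟨-, -, ψ', o2, k2⟩ := h2
  obtain ⟨-, n₂, θ, o3, k3⟩ := h3
  obtain ⟨-, -, θ', o4, k4⟩ := h4
  obtain ⟨-, n₃, φ, o5, k5⟩ := h5
  obtain ⟨-, -, φ', o6, k6⟩ := h6
  have c1 : ¬ InCone φ' d := fun h => hL₂M (o5.edge_eq hP o6 k5 h (o5.ne_src n₃) (o5.ne_tgt n₃)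
    (o6.ne_src n₃) (o6.ne_tgt n₃))
  have c2 : ¬ InCone θ d' := fun h => hLM₂ (o3.edge_eq hP o4 h k4 (o3.ne_src n₂) (o3.ne_tgt n₂)
    (o4.ne_src n₂) (o4.ne_tgt n₂))
  have c3 : ¬ InCone φ' (z₂ - z₃) := by
    intro h
    refine ArcChain.not_mem_quadrant o4.2.1 o6.free (k4.cos_nonneg k6) ⟨?_, ?_⟩
    · have := h.1; rw [X_sub] at this; linarith
    · have := h.2; rw [Y_sub] at this; linarith
  have c4 : ¬ InCone θ (z₃ - z₂) := by
    intro h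
    refine ArcChain.not_mem_quadrant o5.2.1 o3.free (k5.cos_nonneg k3) ⟨?_, ?_⟩
    · have := h.1; rw [X_sub] at this; linarith
    · have := h.2; rw [Y_sub] at this; linarith
  have hdd' : cr d d' ≤ 0 := by
    have : cr d d' = - cr d' d := by simp only [cr]; ring
    linarith
  obtain ⟨e1, f1⟩ := k6.dt_nonpos_of_cr_neg c1 c3 (by rw [cr_sub_right]; linarith) hdd
    (by rw [cr_sub_right]; linarith)
  obtain ⟨e2, f2⟩ := k3.dt_nonpos_of_cr_pos c2 c4 (by rw [cr_sub_right]; linarith) hdd'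
    (by rw [cr_sub_right]; linarith)
  have neg : ∀ w, dt w (z₂ - z₃) = - dt w (z₃ - z₂) := by
    intro w; simp only [dt, PiLp.sub_apply]; ring
  have negY : Y φ' (z₂ - z₃) = - Y φ' (z₃ - z₂) := by rw [Y_sub, Y_sub]; ring
  rw [neg] at e1
  rw [negY] at f1
  have A' : 0 < cr d (z₃ - z₂) := by rw [cr_sub_right]; linarith
  have B' : 0 < cr d' (z₃ - z₂) := by rw [cr_sub_right]; linarith
  have hne : z₃ - z₂ ≠ 0 := by
    intro h
    rw [h] at A'
    simp [cr] at A'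
  generalize hδ : z₃ - z₂ = δ at *
  have f3 : 0 < Y θ δ := by
    rw [dt_eq θ] at e1
    rw [cr_eq θ] at A'
    obtain ⟨q1, q2⟩ := k3
    by_contra hn
    have m1 : X θ d * Y θ δ ≤ 0 := mul_nonpos_of_nonneg_of_nonpos q1.le (not_lt.1 hn)
    have m2 : Y θ d * Y θ δ ≤ 0 := mul_nonpos_of_nonneg_of_nonpos q2.le (not_lt.1 hn)
    have m3 : X θ δ < 0 := by
      by_contra hx
      have := mul_nonneg q2.le (not_lt.1 hx)
      linarith
    have := mul_neg_of_pos_of_neg q1 m3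
    linarith
  have f4 : X φ' δ < 0 := by
    rw [dt_eq φ'] at e2
    rw [cr_eq φ'] at B'
    obtain ⟨q1, q2⟩ := k6
    by_contra hn
    have m1 : 0 ≤ Y φ' d' * X φ' δ := mul_nonneg q2.le (not_lt.1 hn)
    have m2 : 0 ≤ X φ' d' * X φ' δ := mul_nonneg q1.le (not_lt.1 hn)
    have m3 : 0 < Y φ' δ := by
      by_contra hx
      have := mul_nonpos_of_nonneg_of_nonpos q1.le (not_lt.1 hx)
      linarith
    have := mul_pos q2 m3
    linarith
  have s1 := o3.strict n₂
  have s2 := o6.strict n₃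
  have y1 : dt L.src δ ≤ dt z₂ δ := by
    obtain ⟨-, -, b1, b2, b3, b4⟩ := o3
    rw [dt_eq θ, dt_eq θ]
    nlinarith
  have y2 : dt z₂ δ < dt z₃ δ := by
    have := dt_self_pos hne
    nth_rw 1 [← hδ] at this
    rw [dt_sub_left] at this
    linarith
  have y3 : dt z₃ δ ≤ dt M.tgt δ := by
    obtain ⟨-, -, b1, b2, b3, b4⟩ := o6
    rw [dt_eq φ', dt_eq φ']
    nlinarith
  have y4 : dt L.src δ < dt L.tgt δ := by
    rw [dt_eq θ, dt_eq θ]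
    nlinarith [mul_pos f3 (sub_pos.2 s1.2), mul_nonneg (neg_nonneg.2 f2) (sub_pos.2 s1.1).le]
  have y5 : dt M.src δ < dt M.tgt δ := by
    rw [dt_eq φ', dt_eq φ']
    nlinarith [mul_pos (neg_pos.2 f4) (sub_pos.2 s2.1), mul_nonneg (neg_nonneg.2 f1)
      (sub_pos.2 s2.2).le]
  have y6 : dt z δ < dt L.tgt δ := o1.dt_lt_tgt n k1 (by linarith) y4
  have y7 : dt M.src δ < dt z δ := o2.src_lt_dt n k2 e2 y5
  obtain ⟨t, ht1, ht2⟩ := exists_between (a₁ := max (dt L.src δ) (dt M.src δ))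
    (a₂ := min (dt L.tgt δ) (dt M.tgt δ))
    (max_lt (lt_min y4 (by linarith)) (lt_min (by linarith) y5))
  rw [max_lt_iff] at ht1
  rw [lt_min_iff] at ht2
  have rot : ∀ w, cr !₂[δ 1, -δ 0] w = dt w δ := by
    intro w; simp [cr, dt]; ring
  exact hLM (o1.1.eq_of_overlap hP o2.1 (d := !₂[δ 1, -δ 0]) (t := t) (by rw [rot]; exact ht1.1)
    (by rw [rot]; exact ht2.1) (by rw [rot]; exact ht1.2) (by rw [rot]; exact ht2.2))

/-- A set of pairs in which every pair strictly minimizes `f` among the pairs with the same first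
entry or `g` among those with the same second entry is small. -/
lemma encard_le_of_no_two_smaller {α β : Type*} (T : Set (α × β)) (f g : α × β → ℝ)
    (h : ∀ a a' b b', (a, b) ∈ T → (a, b') ∈ T → (a', b) ∈ T → a' ≠ a → b' ≠ b →
      f (a, b') ≤ f (a, b) → g (a', b) ≤ g (a, b) → False) :
    T.encard ≤ (Set.univ : Set α).encard + (Set.univ : Set β).encard := by
  have hT : T ⊆ {x ∈ T | ∀ b', (x.1, b') ∈ T → b' ≠ x.2 → f x < f (x.1, b')} ∪
      {x ∈ T | ∀ a', (a', x.2) ∈ T → a' ≠ x.1 → g x < g (a', x.2)} := by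
    rintro ⟨a, b⟩ hx
    by_contra hn
    simp only [Set.mem_union, Set.mem_ofPred_eq, hx, true_and, not_or, not_forall, not_lt] at hn
    obtain ⟨⟨b', hb', hne, hle⟩, ⟨a', ha', hne', hle'⟩⟩ := hn
    exact h a a' b b' hx hb' ha' hne' hne hle hle'
  refine (Set.encard_le_encard hT).trans ((Set.encard_union_le _ _).trans (add_le_add ?_ ?_))
  · refine Set.encard_le_encard_of_injOn (f := Prod.fst) (fun _ _ => Set.mem_univ _) ?_
    rintro ⟨a, b⟩ ⟨h1, h2⟩ ⟨a', b'⟩ ⟨h1', h2'⟩ (rfl : a = a')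
    by_contra hne
    have hb : b' ≠ b := fun e => hne (by rw [e])
    exact lt_asymm (h2 b' h1' hb) (h2' b h1 hb.symm)
  · refine Set.encard_le_encard_of_injOn (f := Prod.snd) (fun _ _ => Set.mem_univ _) ?_
    rintro ⟨a, b⟩ ⟨h1, h2⟩ ⟨a', b'⟩ ⟨h1', h2'⟩ (rfl : b = b')
    by_contra hne
    have ha : a' ≠ a := fun e => hne (by rw [e])
    exact lt_asymm (h2 a' h1' ha) (h2' a h1 ha.symm)

/-- The pairs of links of different subchains with a common point outside `P`, as witnessed by
quadrants containing the directions `d` and `d'`, respectively. -/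
def crossingPairs (P : Finset Plane) (d d' : Plane) : Set (Link P × Link P) :=
  {x | ¬ x.1.SameSubchain x.2 ∧ ∃ z, Visits x.1 d z ∧ Visits x.2 d' z}

lemma Link.SameSubchain.symm {L M : Link P} (h : L.SameSubchain M) : M.SameSubchain L :=
  ⟨h.1.symm, h.2.symm⟩

lemma encard_crossingPairs_le (hP : NoThreeCollinear P) (d d' : Plane) :
    (crossingPairs P d d').encard ≤
      (Set.univ : Set (Link P)).encard + (Set.univ : Set (Link P)).encard := by
  have hz : ∀ x : Link P × Link P, ∃ z, x ∈ crossingPairs P d d' →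
      Visits x.1 d z ∧ Visits x.2 d' z := by
    intro x
    by_cases hx : x ∈ crossingPairs P d d'
    · exact ⟨hx.2.choose, fun _ => hx.2.choose_spec⟩
    · exact ⟨0, fun h => absurd h hx⟩
  choose z hz using hz
  rcases le_total 0 (cr d' d) with h | h
  · refine encard_le_of_no_two_smaller _ (fun x => cr d' (z x)) (fun x => - cr d (z x)) ?_
    intro a a' b b' h1 h2 h3 ha hb hf hg
    exact Visits.not_zigzag hP h ha hb h1.1 h2.1 h3.1 (hz _ h1).1 (hz _ h1).2 (hz _ h2).1
      (hz _ h2).2 (hz _ h3).1 (hz _ h3).2 hf (neg_le_neg_iff.1 hg)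
  · refine encard_le_of_no_two_smaller _ (fun x => - cr d' (z x)) (fun x => cr d (z x)) ?_
    intro a a' b b' h1 h2 h3 ha hb hf hg
    have h' : 0 ≤ cr d d' := by
      have : cr d d' = - cr d' d := by simp only [cr]; ring
      linarith
    exact Visits.not_zigzag hP h' hb ha (fun e => h1.1 e.symm) (fun e => h3.1 e.symm)
      (fun e => h2.1 e.symm) (hz _ h1).2 (hz _ h1).1 (hz _ h3).2 (hz _ h3).1 (hz _ h2).2
      (hz _ h2).1 hg (neg_le_neg_iff.1 hf)

end Crossings

/-! ### Counting links and pairs of links -/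

section Counting
variable {P : Finset Plane}

/-- Eight directions at angles of 45° (and the zero vector), indexed by the signs of
their coordinates. -/
def dir (σ : SignType × SignType) : Plane := !₂[(σ.1 : ℝ), (σ.2 : ℝ)]

lemma exists_inCone_dir (θ : ℝ) : ∃ σ, InCone θ (dir σ) := by
  -- the signs of the coordinates of the bisector of the quadrant
  refine ⟨(SignType.sign (Real.cos θ - Real.sin θ), SignType.sign (Real.cos θ + Real.sin θ)), ?_⟩
  have h := Real.sin_sq_add_cos_sq θ
  rcases lt_trichotomy (Real.cos θ - Real.sin θ) 0 with h1 | h1 | h1 <;>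
  rcases lt_trichotomy (Real.cos θ + Real.sin θ) 0 with h2 | h2 | h2 <;>
  constructor <;> simp [dir, X, Y, h1, h2] <;> nlinarith

lemma proj_le_proj_tgt {u v a : Plane} (ha : a ∈ subchain P u v) : proj u v a ≤ proj u v v := by
  obtain ⟨θ, -, b1, b2, b3, b4⟩ := ha
  have := proj_sub_proj θ u v a v
  nlinarith

lemma proj_src_le_proj {u v a : Plane} (ha : a ∈ subchain P u v) : proj u v u ≤ proj u v a := by
  obtain ⟨θ, -, b1, b2, b3, b4⟩ := ha
  have := proj_sub_proj θ u v u a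
  nlinarith

lemma Link.fst_ne_tgt (L : Link P) : L.fst ≠ L.tgt := by
  intro h
  have h1 := L.lt
  have h2 := proj_le_proj_tgt L.snd_mem_subchain
  rw [h] at h1
  linarith

lemma Link.snd_ne_src (L : Link P) : L.snd ≠ L.src := by
  intro h
  have h1 := L.lt
  have h2 := proj_src_le_proj L.fst_mem_subchain
  rw [h] at h1
  linarith

lemma Link.eq_of_fst_eq {L M : Link P} (h : L.SameSubchain M) (hf : L.fst = M.fst) : L = M := by
  have h1 := L.lt
  have h2 := M.lt
  rw [← h.1, ← h.2] at h2
  rcases Link.eq_or_le_or_le h with e | e | e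
  · exact e
  · rw [← hf] at e; linarith
  · rw [hf] at e; linarith

lemma Link.eq_of_snd_eq {L M : Link P} (h : L.SameSubchain M) (hs : L.snd = M.snd) : L = M := by
  have h1 := L.lt
  have h2 := M.lt
  rw [← h.1, ← h.2] at h2
  rcases Link.eq_or_le_or_le h with e | e | e
  · exact e
  · rw [hs] at e; linarith
  · rw [← hs] at e; linarith

lemma IsHullEdge.tgt_unique (hP : NoThreeCollinear P) {u v v' : Plane} (h : IsHullEdge P u v)
    (h' : IsHullEdge P u v') : v = v' := by
  have h1 := h.cr_nonneg h'.2.1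
  have h2 := h'.cr_nonneg h.2.1
  have h3 : cr (v - u) (v' - u) = - cr (v' - u) (v - u) := by simp only [cr]; ring
  rcases h.eq_or_eq_of_cr_eq_zero hP h'.2.1 (by linarith) with e | e
  · exact absurd e.symm h'.2.2.1
  · exact e.symm

lemma IsHullEdge.src_unique (hP : NoThreeCollinear P) {u u' v : Plane} (h : IsHullEdge P u v)
    (h' : IsHullEdge P u' v) : u = u' := by
  have h1 := h.cr_nonneg h'.1
  have h2 := h'.cr_nonneg h.1
  have h3 : cr (v - u) (u' - u) = - cr (v - u') (u - u') := by
    simp only [cr, PiLp.sub_apply]; ring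
  rcases h.eq_or_eq_of_cr_eq_zero hP h'.1 (by linarith) with e | e
  · exact e.symm
  · exact absurd e h'.2.2.1

/-- A link is determined by its first end point together with one of ten labels: unless that point
is the beginning of the edge, its quadrant contains one of the fixed directions, which determines
the edge. -/
lemma exists_label_fst (hP : NoThreeCollinear P) : ∃ f : Link P → Option (SignType × SignType),
    ∀ L M : Link P, L.fst = M.fst → f L = f M → L = M := by
  have key : ∀ L : Link P, ∃ o : Option (SignType × SignType), (o = none ∧ L.fst = L.src) ∨
      (∃ σ θ, o = some σ ∧ L.fst ≠ L.src ∧ OnChain P L.src L.tgt θ L.fst ∧ InCone θ (dir σ)) := by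
    intro L
    by_cases h : L.fst = L.src
    · exact ⟨none, Or.inl ⟨rfl, h⟩⟩
    · obtain ⟨θ, hθ⟩ := exists_onChain L.isHullEdge L.fst_mem_subchain
      obtain ⟨σ, hσ⟩ := exists_inCone_dir θ
      exact ⟨some σ, Or.inr ⟨σ, θ, rfl, h, hθ, hσ⟩⟩
  choose f hf using key
  refine ⟨f, fun L M e ef => ?_⟩
  rcases hf L with ⟨h1, h2⟩ | ⟨σ, θ, h1, h2, h3, h4⟩ <;>
  rcases hf M with ⟨k1, k2⟩ | ⟨τ, φ, k1, k2, k3, k4⟩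
  · have hs : L.src = M.src := by rw [← h2, ← k2, e]
    refine Link.eq_of_fst_eq ⟨hs, L.isHullEdge.tgt_unique hP ?_⟩ e
    rw [hs]; exact M.isHullEdge
  · simp [h1, k1] at ef
  · simp [h1, k1] at ef
  · have hστ : σ = τ := by simpa [h1, k1] using ef
    rw [← hστ] at k4
    have t1 := M.fst_ne_tgt
    rw [← e] at k2 k3 t1
    exact Link.eq_of_fst_eq (h3.edge_eq hP k3 h4 k4 h2 L.fst_ne_tgt k2 t1) e

lemma exists_label_snd (hP : NoThreeCollinear P) : ∃ f : Link P → Option (SignType × SignType),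
    ∀ L M : Link P, L.snd = M.snd → f L = f M → L = M := by
  have key : ∀ L : Link P, ∃ o : Option (SignType × SignType), (o = none ∧ L.snd = L.tgt) ∨
      (∃ σ θ, o = some σ ∧ L.snd ≠ L.tgt ∧ OnChain P L.src L.tgt θ L.snd ∧ InCone θ (dir σ)) := by
    intro L
    by_cases h : L.snd = L.tgt
    · exact ⟨none, Or.inl ⟨rfl, h⟩⟩
    · obtain ⟨θ, hθ⟩ := exists_onChain L.isHullEdge L.snd_mem_subchain
      obtain ⟨σ, hσ⟩ := exists_inCone_dir θ
      exact ⟨some σ, Or.inr ⟨σ, θ, rfl, h, hθ, hσ⟩⟩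
  choose f hf using key
  refine ⟨f, fun L M e ef => ?_⟩
  rcases hf L with ⟨h1, h2⟩ | ⟨σ, θ, h1, h2, h3, h4⟩ <;>
  rcases hf M with ⟨k1, k2⟩ | ⟨τ, φ, k1, k2, k3, k4⟩
  · have hs : L.tgt = M.tgt := by rw [← h2, ← k2, e]
    refine Link.eq_of_snd_eq ⟨L.isHullEdge.src_unique hP ?_, hs⟩ e
    rw [hs]; exact M.isHullEdge
  · simp [h1, k1] at ef
  · simp [h1, k1] at ef
  · have hστ : σ = τ := by simpa [h1, k1] using ef
    rw [← hστ] at k4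
    have t1 := M.snd_ne_src
    rw [← e] at k2 k3 t1
    exact Link.eq_of_snd_eq (h3.edge_eq hP k3 h4 k4 L.snd_ne_src h2 t1 k2) e

lemma encard_univ_label : (Set.univ : Set (Option (SignType × SignType))).encard = 10 := by
  rw [Set.encard_univ, ENat.card_eq_coe_fintype_card]
  rfl

lemma encard_univ_link_le (hP : NoThreeCollinear P) :
    (Set.univ : Set (Link P)).encard ≤ P.card * 10 := by
  obtain ⟨f, hf⟩ := exists_label_fst hP
  have : (Set.univ : Set (Link P)).encard ≤
      ((P : Set Plane) ×ˢ (Set.univ : Set (Option (SignType × SignType)))).encard :=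
    Set.encard_le_encard_of_injOn (f := fun L => (L.fst, f L))
      (fun L _ => ⟨L.fst_mem, Set.mem_univ _⟩)
      (fun L _ M _ e => hf L M (congrArg Prod.fst e) (congrArg Prod.snd e))
  rwa [Set.encard_prod, encard_univ_label, Set.encard_coe_eq_coe_finsetCard] at this

/-- The end points of a link. -/
def Link.endPt (L : Link P) : Bool → Plane
  | true => L.fst
  | false => L.snd

/-- The pairs of links with a prescribed coincidence of end points. -/
def touchingPairs (P : Finset Plane) (b : Bool × Bool) : Set (Link P × Link P) :=
  {x | x.1.endPt b.1 = x.2.endPt b.2}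

lemma encard_touchingPairs_le (hP : NoThreeCollinear P) (b : Bool × Bool) :
    (touchingPairs P b).encard ≤ (Set.univ : Set (Link P)).encard * 10 := by
  have hf : ∃ f : Link P → Option (SignType × SignType),
      ∀ L M : Link P, L.endPt b.2 = M.endPt b.2 → f L = f M → L = M := by
    obtain ⟨b1, _ | _⟩ := b
    · exact exists_label_snd hP
    · exact exists_label_fst hP
  obtain ⟨f, hf⟩ := hf
  rw [← encard_univ_label, ← Set.encard_prod]
  refine Set.encard_le_encard_of_injOn (f := fun x => (x.1, f x.2))
    (fun x _ => ⟨Set.mem_univ _, Set.mem_univ _⟩) ?_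
  rintro ⟨L, M⟩ h ⟨L', M'⟩ h' e
  obtain rfl : L = L' := congrArg Prod.fst e
  have := hf M M' (Eq.trans (Eq.symm h) h') (congrArg Prod.snd e)
  rw [this]

/-- Pairs of distinct links that meet share an end point or cross outside `P`. -/
lemma meetingPairs_subset :
    {x : Link P × Link P | x.1 ≠ x.2 ∧ (x.1.carrier ∩ x.2.carrier).Nonempty} ⊆
      (⋃ b, touchingPairs P b) ∪ ⋃ σ : (SignType × SignType) × (SignType × SignType),
        crossingPairs P (dir σ.1) (dir σ.2) := by
  rintro ⟨L, M⟩ ⟨hne, z, hL, hM⟩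
  simp only at hne hL hM
  by_cases hz : z ∈ P
  · left
    rw [Set.mem_iUnion]
    rcases L.eq_fst_or_eq_snd hL hz with h | h <;> rcases M.eq_fst_or_eq_snd hM hz with k | k
    · exact ⟨(true, true), h.symm.trans k⟩
    · exact ⟨(true, false), h.symm.trans k⟩
    · exact ⟨(false, true), h.symm.trans k⟩
    · exact ⟨(false, false), h.symm.trans k⟩
  · right
    rw [Set.mem_iUnion]
    have hs : ¬ L.SameSubchain M := by
      intro hs
      rcases Link.common_of_sameSubchain hne hs hL hM with h | h
      · exact hz (h.2 ▸ L.snd_mem)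
      · exact hz (h.2 ▸ L.fst_mem)
    obtain ⟨θ, hθ⟩ := exists_onChain L.isHullEdge hL.1
    obtain ⟨φ, hφ⟩ := exists_onChain M.isHullEdge hM.1
    obtain ⟨σ, hσ⟩ := exists_inCone_dir θ
    obtain ⟨τ, hτ⟩ := exists_inCone_dir φ
    exact ⟨(σ, τ), hs, z, ⟨hL, hz, θ, hθ, hσ⟩, ⟨hM, hz, φ, hφ, hτ⟩⟩

lemma encard_meetingPairs_le (hP : NoThreeCollinear P) :
    {x : Link P × Link P | x.1 ≠ x.2 ∧ (x.1.carrier ∩ x.2.carrier).Nonempty}.encard ≤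
      (2020 * P.card : ℕ) := by
  have hN := encard_univ_link_le hP
  have h1 : (⋃ b, touchingPairs P b).encard ≤ 4 * (P.card * 10 * 10) := by
    refine (Set.encard_iUnion_le_of_fintype _).trans ?_
    refine (Finset.sum_le_card_nsmul _ _ (P.card * 10 * 10 : ℕ∞) fun b _ =>
      (encard_touchingPairs_le hP b).trans (by gcongr)).trans_eq ?_
    rw [nsmul_eq_mul]; rfl
  have h2 : (⋃ σ : (SignType × SignType) × (SignType × SignType),
      crossingPairs P (dir σ.1) (dir σ.2)).encard ≤ 81 * (P.card * 10 + P.card * 10) := by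
    refine (Set.encard_iUnion_le_of_fintype _).trans ?_
    refine (Finset.sum_le_card_nsmul _ _ (P.card * 10 + P.card * 10 : ℕ∞) fun σ _ =>
      (encard_crossingPairs_le hP _ _).trans (by gcongr)).trans_eq ?_
    rw [nsmul_eq_mul]; rfl
  refine (Set.encard_le_encard meetingPairs_subset).trans
    ((Set.encard_union_le _ _).trans ((add_le_add h1 h2).trans_eq ?_))
  push_cast
  ring

end Counting

end ArcChain

theorem mainTheorem4 :
    -- links of the same subchain meet only at a common end point
    (∀ P : Finset ArcChain.Plane, ArcChain.NoThreeCollinear P →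
      ∀ L M : ArcChain.Link P, L ≠ M → L.SameSubchain M →
        (L.carrier ∩ M.carrier).Subsingleton ∧
        L.carrier ∩ M.carrier ⊆ {L.fst, L.snd} ∩ {M.fst, M.snd}) ∧
    -- links of different subchains meet at most twice
    (∀ P : Finset ArcChain.Plane, ArcChain.NoThreeCollinear P →
      ∀ L M : ArcChain.Link P, ¬ L.SameSubchain M →
        (L.carrier ∩ M.carrier).encard ≤ 2) ∧
    -- linearly many intersecting pairs of links
    (∃ C : ℕ, ∀ P : Finset ArcChain.Plane, ArcChain.NoThreeCollinear P →
      {LM : ArcChain.Link P × ArcChain.Link P |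
        LM.1 ≠ LM.2 ∧ (LM.1.carrier ∩ LM.2.carrier).Nonempty}.encard ≤ (C * P.card : ℕ)) ∧
    -- linearly many intersection points in total
    (∃ C : ℕ, ∀ P : Finset ArcChain.Plane, ArcChain.NoThreeCollinear P →
      {x : ArcChain.Plane | ∃ L M : ArcChain.Link P,
        L ≠ M ∧ x ∈ L.carrier ∧ x ∈ M.carrier}.encard ≤ (C * P.card : ℕ)) := by
  have part1 : ∀ P : Finset ArcChain.Plane, ∀ L M : ArcChain.Link P, L ≠ M → L.SameSubchain M →
      (L.carrier ∩ M.carrier).Subsingleton ∧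
        L.carrier ∩ M.carrier ⊆ {L.fst, L.snd} ∩ {M.fst, M.snd} := by
    intro P L M hne hs
    constructor
    · rintro x ⟨hx, hx'⟩ y ⟨hy, hy'⟩
      have hL := L.lt
      rcases ArcChain.Link.common_of_sameSubchain hne hs hx hx' with ⟨h, e⟩ | ⟨h, e⟩ <;>
      rcases ArcChain.Link.common_of_sameSubchain hne hs hy hy' with ⟨k, e'⟩ | ⟨k, e'⟩
      · rw [e, e']
      -- the links cannot follow each other in both orders
      · have hM := M.lt
        rw [← hs.1, ← hs.2, ← h, ← k] at hM
        linarith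
      · have hM := M.lt
        rw [← hs.1, ← hs.2, ← h, ← k] at hM
        linarith
      · rw [e, e']
    · rintro x ⟨hx, hx'⟩
      rcases ArcChain.Link.common_of_sameSubchain hne hs hx hx' with ⟨h, e⟩ | ⟨h, e⟩
      · exact ⟨Or.inr e, Or.inl (e.trans h)⟩
      · exact ⟨Or.inl e, Or.inr (e.trans h)⟩
  refine ⟨fun P _ => part1 P, fun P hP L M h => ArcChain.Link.encard_inter_le_two hP h,
    ⟨2020, fun P hP => ArcChain.encard_meetingPairs_le hP⟩, ⟨4040, fun P hP => ?_⟩⟩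
  have hS := ArcChain.encard_meetingPairs_le hP
  set S := {x : ArcChain.Link P × ArcChain.Link P |
    x.1 ≠ x.2 ∧ (x.1.carrier ∩ x.2.carrier).Nonempty} with hSdef
  have hfin : S.Finite := Set.finite_of_encard_le_coe hS
  have hsub : {x : ArcChain.Plane | ∃ L M : ArcChain.Link P,
      L ≠ M ∧ x ∈ L.carrier ∧ x ∈ M.carrier} ⊆
      ⋃ LM ∈ hfin.toFinset, LM.1.carrier ∩ LM.2.carrier := by
    rintro x ⟨L, M, hne, hL, hM⟩
    simp only [Set.mem_iUnion]
    exact ⟨(L, M), hfin.mem_toFinset.2 ⟨hne, x, hL, hM⟩, hL, hM⟩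
  have hcard : (hfin.toFinset.card : ℕ∞) ≤ (2020 * P.card : ℕ) := by
    rwa [← hfin.encard_eq_coe_toFinset_card]
  refine (Set.encard_le_encard hsub).trans ((Finset.set_encard_biUnion_le _ _).trans
    ((Finset.sum_le_card_nsmul _ _ 2 fun LM hLM => ?_).trans ?_))
  · by_cases h : LM.1.SameSubchain LM.2
    · exact (Set.encard_le_one_iff_subsingleton.2
        (part1 P _ _ (hfin.mem_toFinset.1 hLM).1 h).1).trans one_le_two
    · exact ArcChain.Link.encard_inter_le_two hP h
  · rw [nsmul_eq_mul]
    calc (hfin.toFinset.card : ℕ∞) * 2 ≤ (2020 * P.card : ℕ) * 2 := by gcongr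
      _ = (4040 * P.card : ℕ) := by push_cast; ring
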